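/- For $n\ge 1$, $b_l,b_r\in[0,1]$ and parameters $0\le\alpha<\alpha^f$, consider the random bipartite graph with left nodes $v^l_1,\dots,v^l_n$ and right nodes $v^r_1,\dots,v^r_n$ generated as follows. Each left node is independently flexible with probability $b_l$, and each right node is independently flexible with probability $b_r$ (the indicators are $F^l_i$ and $F^r_j$); the other nodes are regular. Given these types, the edges $(v^l_i,v^r_j)$ are present independently of each other with probability $$\frac{2\alpha}{n}+(F^l_i+F^r_j)\,\frac{\alpha^f-\alpha}{n}$$ (values above $1$, which occur for only finitely many $n$, are replaced by $1$). Let $\mathcal M_n(b_l,b_r)$ be the maximum number of edges in a matching of this graph, let $\mu_n(b_l,b_r)=\mathbb E[\mathcal M_n(b_l,b_r)/n]$, and let $\mu(b_l,b_r)=\limsup_{n\to\infty}\mu_n(b_l,b_r)$. Theorem. For $B\in(0,1)$ define $$\alpha_\star(B):=\min\left\{\frac{B^2}{8(1-B/2)^3},\ \frac{1}{2(1-B/2)}\ln\left(\frac{2-B}{B}\right)\right\}$$ and, for $0<\alpha<\alpha_\star(B)$, $$\alpha^f_\star(B,\alpha):=\frac{\ln(B)-\ln\left(2\alpha\left[(B/2)^2-2\alpha(1-B/2)^3\right]\right)}{(1-B/2)\,e^{-2\alpha(1-B/2)}-B/2},$$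 which is well defined for such $\alpha$: the argument of the second logarithm is positive and the denominator is nonzero. Then, for every $B\in(0,1)$, $\mu(B/2,B/2)>\mu(B,0)$ whenever $0<\alpha<\alpha_\star(B)$ and $\alpha^f>\alpha^f_\star(B,\alpha)$. -/

import Mathlib

open MeasureTheory ProbabilityTheory Filter

noncomputable section

namespace Flex

/-- The Bernoulli law on `Bool` with success probability `p`. A real number `p` outside `[0,1]`
is moved to the nearest point of `[0,1]`; this only concerns the finitely many market sizes `n`
for which one of the edge probabilities below exceeds `1`. -/
def bernoulliLaw (p : ℝ) : Measure Bool :=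
  bernoulliMeasure true false (Set.projIcc (0 : ℝ) 1 zero_le_one p)

instance (p : ℝ) : IsProbabilityMeasure (bernoulliLaw p) := by
  unfold bernoulliLaw; infer_instance

/-- Types of the `n` left nodes and of the `n` right nodes; `true` means flexible, `false` means
regular. -/
abbrev Types (n : ℕ) : Type := (Fin n → Bool) × (Fin n → Bool)

/-- A bipartite graph between `n` left nodes and `n` right nodes: `R i j = true` means that the
edge between left node `i` and right node `j` is present. -/
abbrev Edges (n : ℕ) : Type := Fin n → Fin n → Bool

/-- All nodes are independently flexible, with probability `bl` on the left and `br` on the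
right. -/
def typeLaw (n : ℕ) (bl br : ℝ) : Measure (Types n) :=
  (Measure.pi fun _ : Fin n => bernoulliLaw bl).prod (Measure.pi fun _ : Fin n => bernoulliLaw br)

instance (n : ℕ) (bl br : ℝ) : IsProbabilityMeasure (typeLaw n bl br) := by
  unfold typeLaw; infer_instance

/-- Conditional probability of an edge, `2 pₙ + (f + g) (pₙᶠ - pₙ)` with `pₙ = α / n` and
`pₙᶠ = αf / n`, where `f` and `g` are the types of its left and its right node. -/
def edgeProb (n : ℕ) (α αf : ℝ) (f g : Bool) : ℝ :=
  2 * (α / n) + ((f.toNat : ℝ) + (g.toNat : ℝ)) * (αf / n - α / n)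

/-- Given the types, the edges are independent. -/
def edgeKernel (n : ℕ) (α αf : ℝ) : Kernel (Types n) (Edges n) :=
  Kernel.ofFunOfCountable fun F =>
    Measure.pi fun i => Measure.pi fun j => bernoulliLaw (edgeProb n α αf (F.1 i) (F.2 j))

instance (n : ℕ) (α αf : ℝ) : IsMarkovKernel (edgeKernel n α αf) := by
  constructor
  intro F
  change IsProbabilityMeasure (Measure.pi fun i => Measure.pi fun j =>
    bernoulliLaw (edgeProb n α αf (F.1 i) (F.2 j)))
  infer_instance

/-- Joint law of the node types and of the random bipartite graph. -/
def graphLaw (n : ℕ) (α αf bl br : ℝ) : Measure (Types n × Edges n) :=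
  typeLaw n bl br ⊗ₘ edgeKernel n α αf

instance (n : ℕ) (α αf bl br : ℝ) : IsProbabilityMeasure (graphLaw n α αf bl br) := by
  unfold graphLaw; infer_instance

/-- A matching: a set of edges of the graph such that no node is in two of them. -/
def IsMatching {n : ℕ} (R : Edges n) (M : Finset (Fin n × Fin n)) : Prop :=
  (∀ e ∈ M, R e.1 e.2 = true) ∧
    ∀ e ∈ M, ∀ e' ∈ M, e.1 = e'.1 ∨ e.2 = e'.2 → e = e'

open Classical in
/-- The largest number of edges of a matching. -/
def maxMatchingSize {n : ℕ} (R : Edges n) : ℕ :=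
  (Finset.univ.filter fun M : Finset (Fin n × Fin n) => IsMatching R M).sup Finset.card

/-- The matching probability `μₙ(bl, br)`: the expectation of the maximum matching size divided
by `n`. -/
def matchingProbN (n : ℕ) (α αf bl br : ℝ) : ℝ :=
  ∫ ω, (maxMatchingSize ω.2 : ℝ) / n ∂graphLaw n α αf bl br

/-- The asymptotic matching probability `μ(bl, br)`. The sequence takes its values in `[0,1]`
(`matchingProbN_mem_Icc`), so this real upper limit is the usual one. -/
def matchingProb (α αf bl br : ℝ) : ℝ :=
  limsup (fun n : ℕ => matchingProbN n α αf bl br) atTop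

theorem maxMatchingSize_le {n : ℕ} (R : Edges n) : maxMatchingSize R ≤ n := by
  classical
  unfold maxMatchingSize
  refine Finset.sup_le fun M hM => ?_
  have h := (Finset.mem_filter.1 hM).2
  have := Finset.card_le_card_of_injOn (s := M) (t := Finset.univ) Prod.fst
    (fun _ _ => Finset.mem_univ _) (fun e he e' he' hee => h.2 e he e' he' (Or.inl hee))
  simpa using this

theorem matchingProbN_mem_Icc (n : ℕ) (α αf bl br : ℝ) :
    matchingProbN n α αf bl br ∈ Set.Icc (0 : ℝ) 1 := by
  have h1 : ∀ ω : Types n × Edges n, (maxMatchingSize ω.2 : ℝ) / n ≤ 1 := fun ω =>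
    div_le_one_of_le₀ (by exact_mod_cast maxMatchingSize_le ω.2) (Nat.cast_nonneg n)
  refine ⟨integral_nonneg fun ω => by positivity, ?_⟩
  calc matchingProbN n α αf bl br ≤ ∫ _, (1 : ℝ) ∂graphLaw n α αf bl br :=
        integral_mono Integrable.of_finite (integrable_const _) h1
    _ = 1 := by simp

/-- The upper threshold for `α`. -/
def alphaStar (B : ℝ) : ℝ :=
  min (B ^ 2 / (8 * (1 - B / 2) ^ 3)) (1 / (2 * (1 - B / 2)) * Real.log ((2 - B) / B))

/-- The lower threshold for `αf`. -/
def alphaFStar (B α : ℝ) : ℝ :=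
  (Real.log B - Real.log (2 * α * ((B / 2) ^ 2 - 2 * α * (1 - B / 2) ^ 3))) /
    ((1 - B / 2) * Real.exp (-2 * α * (1 - B / 2)) - B / 2)

end Flex

end

namespace Flex

/-! Put `b = B / 2` and `x = (1 - b) * exp (-2 * α * (1 - b))`. The proof compares an upper bound
for the one-sided market with a lower bound for the balanced one.

One-sided market: a matching has at most one edge per flexible left node, plus at most all edges at
regular left nodes. Since every right node is regular, this gives `μ(B, 0) ≤ B + 2α(1 - B)`
(`matchingProb_one_sided_le`).

Balanced market: three vertex-disjoint matchings are combined (`maxMatchingSize_ge`). Regular edges,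
after removal of conflicts, contribute at least `2α(1 - b)² - (2α)²(1 - b)³` per node. Flexible
right nodes are matched greedily into regular left nodes without regular neighbours, and
symmetrically with the sides exchanged. About `x n` such left nodes face about `b n` flexible right
nodes, so each greedy choice fails with probability at most about `exp (-(α + αf) * (x - b))`. The
two cross matchings thus contribute almost `2b = B` when `αf` is large (`matchingProb_balanced_ge`).

Since `(1 - b)² - (1 - 2b) = b²`, the balanced bound exceeds the one-sided bound by `2α(b² - 2α(1 -
b)³)` minus the greedy loss. The threshold for `αf` makes that loss smaller than the gain. -/

theorem integral_bernoulliLaw {p : ℝ} (h0 : 0 ≤ p) (h1 : p ≤ 1) (g : Bool → ℝ) :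
    ∫ x, g x ∂bernoulliLaw p = p * g true + (1 - p) * g false := by
  unfold bernoulliLaw
  rw [Set.projIcc_of_mem zero_le_one (⟨h0, h1⟩ : p ∈ Set.Icc (0 : ℝ) 1)]
  simp [integral_bernoulliMeasure]

/-! ### Independence in finite products of Bernoulli laws -/

section Product

variable {ι : Type*} [Fintype ι] [DecidableEq ι] (μ : ι → Measure Bool)
  [∀ i, IsProbabilityMeasure (μ i)]

theorem integral_pi_bool (f : (ι → Bool) → ℝ) :
    ∫ x, f x ∂Measure.pi μ = ∑ x, (∏ i, (μ i).real {x i}) * f x := by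
  rw [integral_fintype Integrable.of_finite]
  refine Finset.sum_congr rfl fun x _ => ?_
  rw [smul_eq_mul]
  congr 1
  simp [measureReal_def, Measure.pi_singleton, ENNReal.toReal_prod]

/-- A function that ignores the coordinate `e` is independent of that coordinate. -/
theorem integral_pi_mul_eval (e : ι) (f : (ι → Bool) → ℝ) (g : Bool → ℝ)
    (hf : ∀ x b, f (Function.update x e b) = f x) :
    ∫ x, f x * g (x e) ∂Measure.pi μ = (∫ x, f x ∂Measure.pi μ) * ∫ y, g y ∂μ e := by
  -- The second factor does not depend on `h`, so the case `h = 1` identifies it with the integral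
  -- of `f`. The value `true` at the coordinate `e` is an arbitrary filler, as `f` ignores it.
  have key : ∀ h : Bool → ℝ, ∫ x, f x * h (x e) ∂Measure.pi μ =
      (∫ y, h y ∂μ e) * ∑ z : {j // j ≠ e} → Bool,
        (∏ i : {j // j ≠ e}, (μ i).real {z i}) *
          f ((Equiv.funSplitAt e Bool).symm (true, z)) := by
    intro h
    rw [integral_pi_bool, ← (Equiv.funSplitAt e Bool).symm.sum_comp, Fintype.sum_prod_type,
      integral_fintype Integrable.of_finite, Finset.sum_mul]
    refine Finset.sum_congr rfl fun a _ => ?_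
    rw [Finset.mul_sum]
    refine Finset.sum_congr rfl fun z _ => ?_
    have h1 : (Equiv.funSplitAt e Bool).symm (a, z) =
        Function.update ((Equiv.funSplitAt e Bool).symm (true, z)) e a := by
      ext j
      by_cases hj : j = e
      · subst hj; simp
      · simp [hj]
    have h2 : ∏ i, (μ i).real {(Equiv.funSplitAt e Bool).symm (a, z) i} =
        (μ e).real {a} * ∏ i : {j // j ≠ e}, (μ i).real {z i} := by
      rw [Fintype.prod_eq_mul_prod_subtype_ne _ e]
      congr 1
      · simp
      · refine Finset.prod_congr rfl fun i _ => ?_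
        simp [i.2]
    have h3 : (Equiv.funSplitAt e Bool).symm (a, z) e = a := by simp
    rw [h2, h3, h1, hf, smul_eq_mul]
    ring
  have h1 := key fun _ => 1
  simp only [mul_one, integral_const, probReal_univ, smul_eq_mul, one_mul] at h1
  rw [key g, h1, mul_comm]

theorem integral_pi_mul_prod (V : Finset ι) (f : (ι → Bool) → ℝ) (g : ι → Bool → ℝ)
    (hf : ∀ e ∈ V, ∀ x b, f (Function.update x e b) = f x) :
    ∫ x, f x * ∏ e ∈ V, g e (x e) ∂Measure.pi μ =
      (∫ x, f x ∂Measure.pi μ) * ∏ e ∈ V, ∫ y, g e y ∂μ e := by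
  induction V using Finset.induction_on with
  | empty => simp
  | insert a V ha ih =>
    rw [Finset.prod_insert ha, mul_left_comm,
      ← ih fun e he => hf e (Finset.mem_insert_of_mem he), mul_comm (∫ y, g a y ∂μ a),
      ← integral_pi_mul_eval]
    · refine integral_congr_ae (Eventually.of_forall fun x => ?_)
      simp only [Finset.prod_insert ha]
      ring
    · intro x b
      rw [hf a (Finset.mem_insert_self _ _)]
      congr 1
      refine Finset.prod_congr rfl fun e he => ?_
      rw [Function.update_of_ne (ne_of_mem_of_not_mem he ha)]

theorem integral_pi_prod (V : Finset ι) (g : ι → Bool → ℝ) :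
    ∫ x, ∏ e ∈ V, g e (x e) ∂Measure.pi μ = ∏ e ∈ V, ∫ y, g e y ∂μ e := by
  simpa using integral_pi_mul_prod μ V (fun _ => 1) g (fun _ _ _ _ => rfl)

/-- If the random set `U` of coordinates does not look at the coordinates that it may contain,
then those can be integrated out separately. -/
theorem integral_pi_prod_random (V : Finset ι) (U : (ι → Bool) → Finset ι) (g : ι → Bool → ℝ)
    (hUV : ∀ x, U x ⊆ V) (hU : ∀ e ∈ V, ∀ x b, U (Function.update x e b) = U x) :
    ∫ x, ∏ e ∈ U x, g e (x e) ∂Measure.pi μ =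
      ∫ x, ∏ e ∈ U x, ∫ y, g e y ∂μ e ∂Measure.pi μ := by
  -- Decompose by the value `W` of the random set: the event `U x = W` does not involve the
  -- coordinates in `W ⊆ V`, so the deterministic case applies to each term.
  have split : ∀ (x : ι → Bool) (h : ι → ℝ), ∏ e ∈ U x, h e =
      ∑ W ∈ V.powerset, (if U x = W then (1 : ℝ) else 0) * ∏ e ∈ W, h e := by
    intro x h
    rw [Finset.sum_eq_single (U x)]
    · simp
    · intro W _ hW
      simp [Ne.symm hW]
    · intro hx
      exact absurd (Finset.mem_powerset.2 (hUV x)) hx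
  have e1 : ∀ x, ∏ e ∈ U x, g e (x e) = _ := fun x => split x fun e => g e (x e)
  have e2 : ∀ x, ∏ e ∈ U x, ∫ y, g e y ∂μ e = _ := fun x => split x fun e => ∫ y, g e y ∂μ e
  simp only [e1, e2]
  rw [integral_finsetSum _ fun _ _ => Integrable.of_finite,
    integral_finsetSum _ fun _ _ => Integrable.of_finite]
  refine Finset.sum_congr rfl fun W hW => ?_
  rw [integral_pi_mul_prod, integral_mul_const]
  intro e he x b
  rw [hU e (Finset.mem_powerset.1 hW he)]

end Product

/-! ### Greedy matching by deferred decisions -/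

section Greedy

variable {κ l : Type*} [Fintype κ] [Fintype l] [DecidableEq κ] [DecidableEq l]

/-- Greedy matching: the nodes of `S` choose one after the other an unused neighbour in the random
set `I x`, which does not look at the edges between them. -/
theorem exists_greedy_matching (p : κ × l → ℝ) (I : (κ × l → Bool) → Finset κ) (J : Finset l)
    (hI : ∀ x i, ∀ j ∈ J, ∀ b, I (Function.update x (i, j) b) = I x)
    {c : ℝ} (hc0 : 0 ≤ c) (hc1 : c ≤ 1) (hp : ∀ x, ∀ i ∈ I x, ∀ j ∈ J, p (i, j) = c)
    (S : Finset l) (hS : S ⊆ J) :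
    ∃ A : (κ × l → Bool) → Finset (κ × l),
      (∀ x, A x ⊆ I x ×ˢ S) ∧ (∀ x, ∀ e ∈ A x, x e = true) ∧
      (∀ x, ∀ e ∈ A x, ∀ e' ∈ A x, e.1 = e'.1 ∨ e.2 = e'.2 → e = e') ∧
      (∀ x i, ∀ j ∈ J, j ∉ S → ∀ b, A (Function.update x (i, j) b) = A x) ∧
      (S.card : ℝ) * (1 - ∫ x, (1 - c) ^ ((I x).card - J.card)
          ∂Measure.pi fun e => bernoulliLaw (p e)) ≤
        ∫ x, ((A x).card : ℝ) ∂Measure.pi fun e => bernoulliLaw (p e) := by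
  classical
  induction S using Finset.induction_on with
  | empty => exact ⟨fun _ => ∅, by simp⟩
  | insert a S ha ih =>
    obtain ⟨A, hA1, hA2, hA3, hA4, hA5⟩ := ih ((Finset.subset_insert a S).trans hS)
    have haJ : a ∈ J := hS (Finset.mem_insert_self a S)
    let T : (κ × l → Bool) → Finset κ := fun x => I x \ (A x).image Prod.fst
    -- The set of still unused candidates is determined without looking at the edges of `a`, which
    -- are therefore fresh when `a` chooses.
    have hT : ∀ x i b, T (Function.update x (i, a) b) = T x := fun x i b => by
      simp only [T, hI x i a haJ, hA4 x i a haJ ha]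
    let N : (κ × l → Bool) → Finset κ := fun x => (T x).filter fun i => x (i, a) = true
    let A' : (κ × l → Bool) → Finset (κ × l) := fun x =>
      if h : (N x).Nonempty then insert (h.choose, a) (A x) else A x
    have hch : ∀ x (h : (N x).Nonempty), h.choose ∈ T x ∧ x (h.choose, a) = true := fun x h =>
      Finset.mem_filter.1 h.choose_spec
    have hnew : ∀ x i j, (i, j) ∈ A x → j ≠ a := fun x i j hij hja =>
      ha (hja ▸ (Finset.mem_product.1 (hA1 x hij)).2)
    have hTA : ∀ x i, i ∈ T x → ∀ j, (i, j) ∉ A x := fun x i hi j hij =>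
      (Finset.mem_sdiff.1 hi).2 (Finset.mem_image_of_mem Prod.fst hij)
    refine ⟨A', ?_, ?_, ?_, ?_, ?_⟩
    · intro x
      by_cases h : (N x).Nonempty
      · simp only [A', h, dif_pos]
        refine Finset.insert_subset ?_ ((hA1 x).trans
          (Finset.product_subset_product_right (Finset.subset_insert a S)))
        exact Finset.mem_product.2 ⟨(Finset.mem_sdiff.1 (hch x h).1).1, Finset.mem_insert_self a S⟩
      · simp only [A', h, dif_neg, not_false_eq_true]
        exact (hA1 x).trans (Finset.product_subset_product_right (Finset.subset_insert a S))
    · intro x e he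
      by_cases h : (N x).Nonempty
      · simp only [A', h, dif_pos, Finset.mem_insert] at he
        rcases he with rfl | he
        · exact (hch x h).2
        · exact hA2 x e he
      · simp only [A', h, dif_neg, not_false_eq_true] at he
        exact hA2 x e he
    · intro x e he e' he' hee
      by_cases h : (N x).Nonempty
      · simp only [A', h, dif_pos, Finset.mem_insert] at he he'
        rcases he with rfl | he <;> rcases he' with rfl | he'
        · rfl
        · rcases hee with hee | hee
          · exact absurd he' (by
              have := hTA x _ (hch x h).1 e'.2
              rwa [show e' = (h.choose, e'.2) from Prod.ext hee.symm rfl])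
          · exact absurd hee.symm (hnew x e'.1 e'.2 he')
        · rcases hee with hee | hee
          · exact absurd he (by
              have := hTA x _ (hch x h).1 e.2
              rwa [show e = (h.choose, e.2) from Prod.ext hee rfl])
          · exact absurd hee (hnew x e.1 e.2 he)
        · exact hA3 x e he e' he' hee
      · simp only [A', h, dif_neg, not_false_eq_true] at he he'
        exact hA3 x e he e' he' hee
    · intro x i j hj hjS b
      have hja : j ≠ a := fun h => hjS (h ▸ Finset.mem_insert_self a S)
      have hjS' : j ∉ S := fun h => hjS (Finset.mem_insert_of_mem h)
      have e1 : A (Function.update x (i, j) b) = A x := hA4 x i j hj hjS' b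
      have e2 : N (Function.update x (i, j) b) = N x := by
        simp only [N, T, e1, hI x i j hj]
        refine Finset.filter_congr fun k _ => ?_
        rw [Function.update_of_ne (by simp [hja.symm])]
      simp only [A', e1, e2]
    · have hcard : ∀ x, ((A x).card : ℝ) + 1 -
          ∏ e ∈ T x ×ˢ {a},
            (if x e = true then (0 : ℝ) else 1) ≤ ((A' x).card : ℝ) := by
        intro x
        simp only [Finset.prod_product, Finset.prod_singleton]
        by_cases h : (N x).Nonempty
        · have h1 : (h.choose, a) ∉ A x := hTA x _ (hch x h).1 a
          have h0 : ∏ i ∈ T x, (if x (i, a) = true then (0 : ℝ) else 1) = 0 :=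
            Finset.prod_eq_zero (hch x h).1 (by simp [(hch x h).2])
          simp only [A', h, dif_pos, Finset.card_insert_of_notMem h1]
          simp [h0]
        · have h0 : ∏ i ∈ T x, (if x (i, a) = true then (0 : ℝ) else 1) = 1 := by
            refine Finset.prod_eq_one fun i hi => ?_
            have : ¬ x (i, a) = true := fun hx => h ⟨i, Finset.mem_filter.2 ⟨hi, hx⟩⟩
            simp [this]
          simp only [A', h, dif_neg, not_false_eq_true]
          simp [h0]
      have hfail : ∫ x, ∏ e ∈ T x ×ˢ {a},
            (if x e = true then (0 : ℝ) else 1) ∂Measure.pi (fun e => bernoulliLaw (p e)) ≤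
          ∫ x, (1 - c) ^ ((I x).card - J.card) ∂Measure.pi fun e => bernoulliLaw (p e) := by
        rw [integral_pi_prod_random (fun e => bernoulliLaw (p e)) (Finset.univ ×ˢ {a}) _
          (fun _ b => if b = true then (0 : ℝ) else 1)]
        · refine integral_mono Integrable.of_finite Integrable.of_finite fun x => ?_
          simp only [Finset.prod_product, Finset.prod_singleton]
          have : ∀ i ∈ T x, ∫ y, (if y = true then (0 : ℝ) else 1) ∂bernoulliLaw (p (i, a)) =
              1 - c := by
            intro i hi
            rw [hp x i (Finset.mem_sdiff.1 hi).1 a haJ, integral_bernoulliLaw hc0 hc1]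
            simp
          rw [Finset.prod_congr rfl this, Finset.prod_const]
          -- At most `S.card ≤ J.card` candidates are used up, so at least `(I x).card - J.card`
          -- remain. The subtraction is truncated: with too few candidates the failure bound is just
          -- `1`.
          refine pow_le_pow_of_le_one (by linarith) (by linarith) ?_
          have h1 : (A x).card ≤ S.card := by
            refine Finset.card_le_card_of_injOn Prod.snd
              (fun e he => (Finset.mem_product.1 (hA1 x he)).2)
              (fun e he e' he' hee => hA3 x e he e' he' (Or.inr hee))
          have h2 : S.card ≤ J.card :=
            Finset.card_le_card ((Finset.subset_insert a S).trans hS)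
          have h3 : (I x).card ≤ (T x).card + ((A x).image Prod.fst).card :=
            Finset.card_le_card_sdiff_add_card
          have h4 : ((A x).image Prod.fst).card ≤ (A x).card := Finset.card_image_le
          omega
        · intro x e he
          exact Finset.mem_product.2 ⟨Finset.mem_univ _, (Finset.mem_product.1 he).2⟩
        · rintro ⟨i, j⟩ he x b
          obtain rfl : a = j := by simpa using he
          rw [hT]
      have hmono := integral_mono (μ := Measure.pi fun e => bernoulliLaw (p e))
        Integrable.of_finite Integrable.of_finite hcard
      rw [integral_sub Integrable.of_finite Integrable.of_finite,
        integral_add Integrable.of_finite Integrable.of_finite] at hmono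
      simp only [integral_const, probReal_univ, smul_eq_mul, one_mul] at hmono
      rw [Finset.card_insert_of_notMem ha]
      push_cast
      linarith

end Greedy

/-! ### Deterministic bounds on the maximum matching -/

variable {n : ℕ}

/-- The regular left nodes that have no regular neighbour. -/
def isolatedLeft (ω : Types n × Edges n) : Finset (Fin n) :=
  Finset.univ.filter fun i => ω.1.1 i = false ∧ ∀ j, ω.1.2 j = false → ω.2 i j = false

/-- The flexible right nodes. -/
def flexibleRight (ω : Types n × Edges n) : Finset (Fin n) :=
  Finset.univ.filter fun j => ω.1.2 j = true

theorem mem_isolatedLeft {ω : Types n × Edges n} {i : Fin n} : i ∈ isolatedLeft ω ↔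
    ω.1.1 i = false ∧ ∀ j, ω.1.2 j = false → ω.2 i j = false := by
  simp [isolatedLeft]

theorem mem_flexibleRight {ω : Types n × Edges n} {j : Fin n} :
    j ∈ flexibleRight ω ↔ ω.1.2 j = true := by
  simp [flexibleRight]

open Classical in
/-- The largest number of edges of a matching between flexible right nodes and those regular left
nodes that have no regular neighbour. -/
noncomputable def crossMatchingSize (ω : Types n × Edges n) : ℕ :=
  (Finset.univ.filter fun M : Finset (Fin n × Fin n) =>
    IsMatching ω.2 M ∧ M ⊆ isolatedLeft ω ×ˢ flexibleRight ω).sup Finset.card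

/-- Exchange of the two sides of the market. -/
def transpose (ω : Types n × Edges n) : Types n × Edges n :=
  (ω.1.swap, fun i j => ω.2 j i)

/-- Indicator of an edge between two regular nodes. -/
noncomputable def regEdge (ω : Types n × Edges n) (i j : Fin n) : ℝ :=
  if ω.1.1 i = false ∧ ω.1.2 j = false ∧ ω.2 i j = true then 1 else 0

theorem card_le_maxMatchingSize {R : Edges n} {M : Finset (Fin n × Fin n)} (h : IsMatching R M) :
    M.card ≤ maxMatchingSize R := by
  classical
  exact Finset.le_sup (f := Finset.card) (Finset.mem_filter.2 ⟨Finset.mem_univ _, h⟩)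

theorem exists_crossMatching (ω : Types n × Edges n) :
    ∃ M, IsMatching ω.2 M ∧ M ⊆ isolatedLeft ω ×ˢ flexibleRight ω ∧
      M.card = crossMatchingSize ω := by
  classical
  obtain ⟨M, hM, h⟩ := Finset.exists_mem_eq_sup
    (Finset.univ.filter fun M : Finset (Fin n × Fin n) =>
      IsMatching ω.2 M ∧ M ⊆ isolatedLeft ω ×ˢ flexibleRight ω)
    ⟨∅, by simp [IsMatching]⟩ Finset.card
  have := (Finset.mem_filter.1 hM).2
  refine ⟨M, this.1, this.2, ?_⟩
  rw [← h]; unfold crossMatchingSize; congr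

theorem card_le_crossMatchingSize {ω : Types n × Edges n} {M : Finset (Fin n × Fin n)}
    (h : IsMatching ω.2 M) (h' : M ⊆ isolatedLeft ω ×ˢ flexibleRight ω) :
    M.card ≤ crossMatchingSize ω := by
  classical
  exact Finset.le_sup (f := Finset.card) (Finset.mem_filter.2 ⟨Finset.mem_univ _, h, h'⟩)

/-- Deleting an edge from each pair of adjacent edges leaves a matching. -/
theorem exists_regular_matching (ω : Types n × Edges n) :
    ∃ M, IsMatching ω.2 M ∧ (∀ e ∈ M, ω.1.1 e.1 = false ∧ ω.1.2 e.2 = false) ∧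
      ∑ i, ∑ j, regEdge ω i j
        - ∑ i, ∑ j, ∑ j' ∈ Finset.Iio j, regEdge ω i j' * regEdge ω i j
        - ∑ i, ∑ j, ∑ i' ∈ Finset.Iio i, regEdge ω i' j * regEdge ω i j ≤ (M.card : ℝ) := by
  classical
  have hnn : ∀ i j, 0 ≤ regEdge ω i j := fun i j => by unfold regEdge; split_ifs <;> norm_num
  -- Keep a regular edge when no regular edge precedes it in its row or in its column. Every deleted
  -- edge is then the later member of some adjacent pair, and the pair sums pay for it.
  let M : Finset (Fin n × Fin n) := Finset.univ.filter fun e =>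
    regEdge ω e.1 e.2 = 1 ∧ (∀ j' < e.2, regEdge ω e.1 j' = 0) ∧ ∀ i' < e.1, regEdge ω i' e.2 = 0
  have hM : ∀ e ∈ M, regEdge ω e.1 e.2 = 1 ∧ (∀ j' < e.2, regEdge ω e.1 j' = 0) ∧
      ∀ i' < e.1, regEdge ω i' e.2 = 0 := fun e he => (Finset.mem_filter.1 he).2
  have hreg : ∀ e ∈ M, ω.1.1 e.1 = false ∧ ω.1.2 e.2 = false ∧ ω.2 e.1 e.2 = true := by
    intro e he
    by_contra h
    have := (hM e he).1
    simp [regEdge, h] at this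
  refine ⟨M, ⟨fun e he => (hreg e he).2.2, ?_⟩, fun e he => ⟨(hreg e he).1, (hreg e he).2.1⟩, ?_⟩
  · intro e he e' he' hee
    obtain ⟨h1, h2, h3⟩ := hM e he
    obtain ⟨h1', h2', h3'⟩ := hM e' he'
    rcases hee with hee | hee
    · refine Prod.ext hee ?_
      rcases lt_trichotomy e.2 e'.2 with h | h | h
      · have := h2' _ h
        rw [← hee, h1] at this
        norm_num at this
      · exact h
      · have := h2 _ h
        rw [hee, h1'] at this
        norm_num at this
    · refine Prod.ext ?_ hee
      rcases lt_trichotomy e.1 e'.1 with h | h | h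
      · have := h3' _ h
        rw [← hee, h1] at this
        norm_num at this
      · exact h
      · have := h3 _ h
        rw [hee, h1'] at this
        norm_num at this
  · have hcard : (M.card : ℝ) = ∑ i, ∑ j, if (i, j) ∈ M then (1 : ℝ) else 0 := by
      rw [← Fintype.sum_prod_type' fun i j => if (i, j) ∈ M then (1 : ℝ) else 0]
      simp
    rw [hcard, ← Finset.sum_sub_distrib, ← Finset.sum_sub_distrib]
    refine Finset.sum_le_sum fun i _ => ?_
    rw [← Finset.sum_sub_distrib, ← Finset.sum_sub_distrib]
    refine Finset.sum_le_sum fun j _ => ?_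
    have s1 : 0 ≤ ∑ j' ∈ Finset.Iio j, regEdge ω i j' * regEdge ω i j :=
      Finset.sum_nonneg fun _ _ => mul_nonneg (hnn _ _) (hnn _ _)
    have s2 : 0 ≤ ∑ i' ∈ Finset.Iio i, regEdge ω i' j * regEdge ω i j :=
      Finset.sum_nonneg fun _ _ => mul_nonneg (hnn _ _) (hnn _ _)
    have h01 : ∀ i j, regEdge ω i j = 0 ∨ regEdge ω i j = 1 := fun i j => by
      unfold regEdge; split_ifs <;> simp
    split_ifs with h
    · have := (hM _ h).1
      simp only at this
      linarith
    · rcases h01 i j with h0 | h1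
      · rw [h0] at s1 s2 ⊢
        linarith
      · have : (∃ j' < j, regEdge ω i j' = 1) ∨ ∃ i' < i, regEdge ω i' j = 1 := by
          by_contra hcon
          push Not at hcon
          exact h (Finset.mem_filter.2 ⟨Finset.mem_univ _, h1,
            fun j' hj' => (h01 i j').resolve_right (hcon.1 j' hj'),
            fun i' hi' => (h01 i' j).resolve_right (hcon.2 i' hi')⟩)
        rcases this with ⟨k, hk, hk1⟩ | ⟨k, hk, hk1⟩
        · have := Finset.single_le_sum (f := fun j' => regEdge ω i j' * regEdge ω i j)
            (fun _ _ => mul_nonneg (hnn _ _) (hnn _ _)) (Finset.mem_Iio.2 hk)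
          simp only [hk1, h1] at this s2 ⊢
          linarith
        · have := Finset.single_le_sum (f := fun i' => regEdge ω i' j * regEdge ω i j)
            (fun _ _ => mul_nonneg (hnn _ _) (hnn _ _)) (Finset.mem_Iio.2 hk)
          simp only [hk1, h1] at this s1 ⊢
          linarith

/-- The regular matching and the two cross matchings share no node: a cross matching joins a
flexible node to a regular node without regular neighbours, which no regular edge can touch, and the
two cross matchings use opposite types on each side. Their union is a matching. -/
theorem maxMatchingSize_ge (ω : Types n × Edges n) :
    ∑ i, ∑ j, regEdge ω i j
        - ∑ i, ∑ j, ∑ j' ∈ Finset.Iio j, regEdge ω i j' * regEdge ω i j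
        - ∑ i, ∑ j, ∑ i' ∈ Finset.Iio i, regEdge ω i' j * regEdge ω i j
        + crossMatchingSize ω + crossMatchingSize (transpose ω) ≤ (maxMatchingSize ω.2 : ℝ) := by
  classical
  obtain ⟨N, hN, hNreg, hNcard⟩ := exists_regular_matching ω
  obtain ⟨A, hA, hAsub, hAcard⟩ := exists_crossMatching ω
  obtain ⟨C, hC, hCsub, hCcard⟩ := exists_crossMatching (transpose ω)
  have hA' : ∀ e ∈ A, ω.1.1 e.1 = false ∧ (∀ j, ω.1.2 j = false → ω.2 e.1 j = false) ∧
      ω.1.2 e.2 = true := by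
    intro e he
    have := hAsub he
    rw [Finset.mem_product, mem_isolatedLeft, mem_flexibleRight] at this
    exact ⟨this.1.1, this.1.2, this.2⟩
  let D : Finset (Fin n × Fin n) := C.map (Equiv.prodComm _ _).toEmbedding
  have hD' : ∀ e ∈ D, ω.1.2 e.2 = false ∧ (∀ i, ω.1.1 i = false → ω.2 i e.2 = false) ∧
      ω.1.1 e.1 = true := by
    intro e he
    obtain ⟨d, hd, rfl⟩ := Finset.mem_map.1 he
    have := hCsub hd
    rw [Finset.mem_product, mem_isolatedLeft, mem_flexibleRight] at this
    exact ⟨this.1.1, this.1.2, this.2⟩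
  have hD : IsMatching ω.2 D := by
    refine ⟨?_, ?_⟩
    · intro e he
      obtain ⟨d, hd, rfl⟩ := Finset.mem_map.1 he
      exact hC.1 d hd
    · intro e he e' he' hee
      obtain ⟨d, hd, rfl⟩ := Finset.mem_map.1 he
      obtain ⟨d', hd', rfl⟩ := Finset.mem_map.1 he'
      rw [hC.2 d hd d' hd' hee.symm]
  have hNA : ∀ e ∈ N, ∀ e' ∈ A, ¬ (e.1 = e'.1 ∨ e.2 = e'.2) := by
    rintro e he e' he' (h | h)
    · have h1 := (hA' e' he').2.1 e.2 (hNreg e he).2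
      rw [← h, hN.1 e he] at h1
      simp at h1
    · have h1 := (hNreg e he).2
      rw [h, (hA' e' he').2.2] at h1
      simp at h1
  have hND : ∀ e ∈ N, ∀ e' ∈ D, ¬ (e.1 = e'.1 ∨ e.2 = e'.2) := by
    rintro e he e' he' (h | h)
    · have h1 := (hNreg e he).1
      rw [h, (hD' e' he').2.2] at h1
      simp at h1
    · have h1 := (hD' e' he').2.1 e.1 (hNreg e he).1
      rw [← h, hN.1 e he] at h1
      simp at h1
  have hAD : ∀ e ∈ A, ∀ e' ∈ D, ¬ (e.1 = e'.1 ∨ e.2 = e'.2) := by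
    rintro e he e' he' (h | h)
    · have h1 := (hA' e he).1
      rw [h, (hD' e' he').2.2] at h1
      simp at h1
    · have h1 := (hA' e he).2.2
      rw [h, (hD' e' he').1] at h1
      simp at h1
  have hmatch : IsMatching ω.2 ((N ∪ A) ∪ D) := by
    refine ⟨?_, ?_⟩
    · intro e he
      rcases Finset.mem_union.1 he with he | he
      · rcases Finset.mem_union.1 he with he | he
        · exact hN.1 e he
        · exact hA.1 e he
      · exact hD.1 e he
    · intro e he e' he' hee
      have hee' : e'.1 = e.1 ∨ e'.2 = e.2 := hee.imp Eq.symm Eq.symm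
      simp only [Finset.mem_union] at he he'
      rcases he with (he | he) | he <;> rcases he' with (he' | he') | he'
      · exact hN.2 e he e' he' hee
      · exact absurd hee (hNA e he e' he')
      · exact absurd hee (hND e he e' he')
      · exact absurd hee' (hNA e' he' e he)
      · exact hA.2 e he e' he' hee
      · exact absurd hee (hAD e he e' he')
      · exact absurd hee' (hND e' he' e he)
      · exact absurd hee' (hAD e' he' e he)
      · exact hD.2 e he e' he' hee
  have hcard : ((N ∪ A) ∪ D).card = N.card + A.card + C.card := by
    rw [Finset.card_union_of_disjoint, Finset.card_union_of_disjoint, Finset.card_map]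
    · exact Finset.disjoint_left.2 fun e he he' => hNA e he e he' (Or.inl rfl)
    · refine Finset.disjoint_left.2 fun e he he' => ?_
      rcases Finset.mem_union.1 he with he | he
      · exact hND e he e he' (Or.inl rfl)
      · exact hAD e he e he' (Or.inl rfl)
  have := card_le_maxMatchingSize hmatch
  rw [hcard] at this
  rw [← hAcard, ← hCcard]
  have h2 : (N.card : ℝ) + A.card + C.card ≤ maxMatchingSize ω.2 := by exact_mod_cast this
  linarith

/-- Every edge of a matching uses a flexible left node or starts at a regular left node. -/
theorem maxMatchingSize_le_flexible_add (ω : Types n × Edges n) :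
    (maxMatchingSize ω.2 : ℝ) ≤ ∑ i, (if ω.1.1 i = true then (1 : ℝ) else 0) +
      ∑ i, ∑ j, (if ω.1.1 i = true then (0 : ℝ) else 1) *
        if ω.2 i j = true then (1 : ℝ) else 0 := by
  classical
  obtain ⟨M, hM, hcard⟩ : ∃ M, IsMatching ω.2 M ∧ M.card = maxMatchingSize ω.2 := by
    obtain ⟨M, hM, h⟩ := Finset.exists_mem_eq_sup
      (Finset.univ.filter fun M : Finset (Fin n × Fin n) => IsMatching ω.2 M)
      ⟨∅, by simp [IsMatching]⟩ Finset.card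
    refine ⟨M, (Finset.mem_filter.1 hM).2, ?_⟩
    rw [← h]; unfold maxMatchingSize; congr
  rw [← hcard, ← Finset.card_filter_add_card_filter_not (s := M) fun e => ω.1.1 e.1 = true]
  push_cast
  refine add_le_add ?_ ?_
  · rw [Finset.sum_boole]
    refine Nat.cast_le.2 (Finset.card_le_card_of_injOn Prod.fst ?_ ?_)
    · intro e he
      simpa using (Finset.mem_filter.1 he).2
    · intro e he e' he' hee
      exact hM.2 e (Finset.mem_filter.1 he).1 e' (Finset.mem_filter.1 he').1 (Or.inl hee)
  · rw [← Fintype.sum_prod_type' fun i j => (if ω.1.1 i = true then (0 : ℝ) else 1) *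
        if ω.2 i j = true then (1 : ℝ) else 0]
    have : ∀ e : Fin n × Fin n, ((if ω.1.1 e.1 = true then (0 : ℝ) else 1) *
        if ω.2 e.1 e.2 = true then (1 : ℝ) else 0) =
        if ¬ ω.1.1 e.1 = true ∧ ω.2 e.1 e.2 = true then 1 else 0 := by
      intro e
      by_cases h : ω.1.1 e.1 = true <;> simp [h]
    simp only [this]
    rw [Finset.sum_boole]
    refine Nat.cast_le.2 (Finset.card_le_card ?_)
    intro e he
    obtain ⟨h1, h2⟩ := Finset.mem_filter.1 he
    exact Finset.mem_filter.2 ⟨Finset.mem_univ _, h2, hM.1 e h1⟩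

/-! ### Conditioning on the types -/

theorem edgeProb_false_false (n : ℕ) (α αf : ℝ) : edgeProb n α αf false false = 2 * α / n := by
  simp [edgeProb]; ring

theorem edgeProb_false_true (n : ℕ) (α αf : ℝ) : edgeProb n α αf false true = (α + αf) / n := by
  simp [edgeProb]; ring

theorem edgeProb_comm (n : ℕ) (α αf : ℝ) (f g : Bool) :
    edgeProb n α αf f g = edgeProb n α αf g f := by
  simp only [edgeProb, add_comm]

/-- The conditional law of the edges given the types, with edges indexed by pairs of nodes. -/
noncomputable def edgeLaw (α αf : ℝ) (F : Types n) : Measure (Fin n × Fin n → Bool) :=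
  Measure.pi fun e => bernoulliLaw (edgeProb n α αf (F.1 e.1) (F.2 e.2))

instance (α αf : ℝ) (F : Types n) : IsProbabilityMeasure (edgeLaw α αf F) := by
  unfold edgeLaw; infer_instance

theorem integral_edgeKernel (α αf : ℝ) (F : Types n) (f : Edges n → ℝ) :
    ∫ R, f R ∂edgeKernel n α αf F = ∫ x, f (Function.curry x) ∂edgeLaw α αf F := by
  rw [edgeLaw, integral_pi_bool, integral_fintype Integrable.of_finite,
    ← (Equiv.curry (Fin n) (Fin n) Bool).sum_comp]
  refine Finset.sum_congr rfl fun x _ => ?_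
  rw [smul_eq_mul]
  congr 1
  change (Measure.pi fun i => Measure.pi fun j =>
    bernoulliLaw (edgeProb n α αf (F.1 i) (F.2 j))).real {Function.curry x} = _
  simp [measureReal_def, Measure.pi_singleton, ENNReal.toReal_prod, Fintype.prod_prod_type,
    Function.curry]

theorem integral_graphLaw (α αf bl br : ℝ) (f : Types n × Edges n → ℝ) :
    ∫ ω, f ω ∂graphLaw n α αf bl br =
      ∫ F, ∫ x, f (F, Function.curry x) ∂edgeLaw α αf F ∂typeLaw n bl br := by
  rw [graphLaw, Measure.integral_compProd Integrable.of_finite]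
  simp only [integral_edgeKernel]

/-- With equal flexibility on both sides the model is symmetric. -/
theorem integral_graphLaw_transpose (α αf b : ℝ) (f : Types n × Edges n → ℝ) :
    ∫ ω, f (transpose ω) ∂graphLaw n α αf b b = ∫ ω, f ω ∂graphLaw n α αf b b := by
  rw [integral_graphLaw, integral_graphLaw, typeLaw, ← integral_prod_swap]
  refine integral_congr_ae (Eventually.of_forall fun F => ?_)
  simp only [edgeLaw]
  rw [integral_pi_bool, integral_pi_bool,
    ← ((Equiv.prodComm (Fin n) (Fin n)).arrowCongr (Equiv.refl Bool)).sum_comp]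
  refine Finset.sum_congr rfl fun x _ => ?_
  congr 1
  rw [← (Equiv.prodComm (Fin n) (Fin n)).prod_comp]
  refine Finset.prod_congr rfl fun e _ => ?_
  simp [edgeProb_comm n α αf (F.2 e.2)]

theorem integral_typeLaw_mul (bl br : ℝ) (f g : (Fin n → Bool) → ℝ) :
    ∫ F, f F.1 * g F.2 ∂typeLaw n bl br =
      (∫ x, f x ∂Measure.pi fun _ : Fin n => bernoulliLaw bl) *
        ∫ x, g x ∂Measure.pi fun _ : Fin n => bernoulliLaw br := by
  rw [typeLaw, integral_prod_mul]

/-- Expectations of products over a block of edges that starts at regular left nodes. -/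
theorem integral_regular_block {α αf bl br : ℝ} (hbl : bl ∈ Set.Icc (0 : ℝ) 1)
    (hbr : br ∈ Set.Icc (0 : ℝ) 1) (hp : 2 * α / n ∈ Set.Icc (0 : ℝ) 1)
    (hpf : (α + αf) / n ∈ Set.Icc (0 : ℝ) 1) (S T : Finset (Fin n)) (G : Bool → Bool → ℝ) :
    ∫ ω, (∏ i ∈ S, if ω.1.1 i = true then (0 : ℝ) else 1) *
        ∏ j ∈ T, ∏ i ∈ S, G (ω.1.2 j) (ω.2 i j) ∂graphLaw n α αf bl br =
      (1 - bl) ^ S.card *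
        (br * ((α + αf) / n * G true true + (1 - (α + αf) / n) * G true false) ^ S.card +
          (1 - br) * (2 * α / n * G false true + (1 - 2 * α / n) * G false false) ^ S.card) ^
            T.card := by
  let h : Bool → ℝ := fun f => ∫ y, G f y ∂bernoulliLaw (edgeProb n α αf false f)
  have inner : ∀ F : Types n, ∫ x, (∏ i ∈ S, if F.1 i = true then (0 : ℝ) else 1) *
      ∏ j ∈ T, ∏ i ∈ S, G (F.2 j) (Function.curry x i j) ∂edgeLaw α αf F =
      (∏ i ∈ S, if F.1 i = true then (0 : ℝ) else 1) * ∏ j ∈ T, h (F.2 j) ^ S.card := by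
    intro F
    rw [integral_const_mul]
    -- If some left node of the block is flexible, both sides vanish. Otherwise each edge law
    -- depends only on the type of its right node, so the integral factors over the block.
    by_cases hS : ∀ i ∈ S, F.1 i = false
    · congr 1
      have := integral_pi_prod (fun e : Fin n × Fin n =>
        bernoulliLaw (edgeProb n α αf (F.1 e.1) (F.2 e.2))) (S ×ˢ T)
        fun e y => G (F.2 e.2) y
      simp only [Finset.prod_product_right] at this
      rw [edgeLaw]
      refine this.trans (Finset.prod_congr rfl fun j _ => ?_)
      rw [← Finset.prod_const]
      refine Finset.prod_congr rfl fun i hi => ?_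
      simp only [h, hS i hi]
    · push Not at hS
      obtain ⟨i, hi, hi'⟩ := hS
      rw [Finset.prod_eq_zero hi (by simpa using hi')]
      simp
  rw [integral_graphLaw]
  simp only [inner]
  rw [integral_typeLaw_mul bl br (fun x => ∏ i ∈ S, if x i = true then (0 : ℝ) else 1)
    fun x => ∏ j ∈ T, h (x j) ^ S.card]
  have e1 := integral_pi_prod (fun _ : Fin n => bernoulliLaw bl) S
    fun _ b => if b = true then (0 : ℝ) else 1
  have e2 := integral_pi_prod (fun _ : Fin n => bernoulliLaw br) T fun _ b => h b ^ S.card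
  rw [e1, e2, Finset.prod_const, Finset.prod_const, integral_bernoulliLaw hbl.1 hbl.2,
    integral_bernoulliLaw hbr.1 hbr.2]
  simp only [h, edgeProb_false_false, edgeProb_false_true, integral_bernoulliLaw hp.1 hp.2,
    integral_bernoulliLaw hpf.1 hpf.2]
  simp

/-- Given the types, the flexible right nodes are fixed, and whether a left node is isolated depends
only on edges to regular right nodes. The edges between the two sets are thus unexplored and all
have probability `(α + αf) / n`, as the greedy argument requires. -/
theorem integral_crossMatchingSize_ge {α αf bl br : ℝ} (hpf : (α + αf) / n ∈ Set.Icc (0 : ℝ) 1) :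
    ∫ ω, ((flexibleRight ω).card : ℝ) *
        (1 - (1 - (α + αf) / n) ^ ((isolatedLeft ω).card - (flexibleRight ω).card))
          ∂graphLaw n α αf bl br ≤
      ∫ ω, (crossMatchingSize ω : ℝ) ∂graphLaw n α αf bl br := by
  rw [integral_graphLaw, integral_graphLaw]
  refine integral_mono Integrable.of_finite Integrable.of_finite fun F => ?_
  let J : Finset (Fin n) := flexibleRight (F, fun _ _ => false)
  have hJ : ∀ R, flexibleRight (F, R) = J := fun R => rfl
  obtain ⟨A, hA1, hA2, hA3, -, hA5⟩ := exists_greedy_matching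
    (fun e : Fin n × Fin n => edgeProb n α αf (F.1 e.1) (F.2 e.2))
    (fun x => isolatedLeft (F, Function.curry x)) J
    (by
      intro x i j hj b
      ext k
      have hj' : F.2 j = true := mem_flexibleRight.1 hj
      simp only [mem_isolatedLeft, Function.curry]
      refine and_congr_right fun _ => forall_congr' fun j' => imp_congr_right fun hj2 => ?_
      have : j' ≠ j := by
        rintro rfl
        rw [hj'] at hj2
        simp at hj2
      rw [Function.update_of_ne (by simp [this])])
    hpf.1 hpf.2
    (by
      intro x i hi j hj
      have h1 : F.1 i = false := (mem_isolatedLeft.1 hi).1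
      have h2 : F.2 j = true := mem_flexibleRight.1 hj
      simp only [h1, h2, edgeProb_false_true])
    J subset_rfl
  simp only [hJ]
  rw [integral_const_mul, integral_sub Integrable.of_finite Integrable.of_finite]
  simp only [integral_const, probReal_univ, smul_eq_mul, one_mul]
  refine hA5.trans (integral_mono Integrable.of_finite Integrable.of_finite fun x => ?_)
  exact Nat.cast_le.2 (card_le_crossMatchingSize ⟨fun e he => hA2 x e he, hA3 x⟩ (hA1 x))

theorem integral_flexibleRight {α αf bl br : ℝ} (hbr : br ∈ Set.Icc (0 : ℝ) 1)
    (T : Finset (Fin n)) :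
    ∫ ω, (∏ j ∈ T, if ω.1.2 j = true then (1 : ℝ) else 0) ∂graphLaw n α αf bl br =
      br ^ T.card := by
  have hconst : ∀ F : Types n, ∫ x, (∏ j ∈ T, if (F, Function.curry x).1.2 j = true
      then (1 : ℝ) else 0) ∂edgeLaw α αf F = ∏ j ∈ T, if F.2 j = true then (1 : ℝ) else 0 := by
    intro F
    change ∫ _, (∏ j ∈ T, if F.2 j = true then (1 : ℝ) else 0) ∂edgeLaw α αf F = _
    simp
  rw [integral_graphLaw]
  simp only [hconst]
  have h := integral_typeLaw_mul (n := n) bl br (fun _ => 1)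
    fun x => ∏ j ∈ T, if x j = true then (1 : ℝ) else 0
  have e := integral_pi_prod (fun _ : Fin n => bernoulliLaw br) T
    fun _ b => if b = true then (1 : ℝ) else 0
  simp only [one_mul] at h
  rw [h, e]
  simp [integral_bernoulliLaw hbr.1 hbr.2]

/-! ### Concentration of the two sides of the cross matching -/

/-- Second moment bound for an average of uncorrelated indicators. -/
theorem integral_sq_average_sub_le {Ω : Type*} [Fintype Ω] [MeasurableSpace Ω]
    [MeasurableSingletonClass Ω] (P : Measure Ω) [IsProbabilityMeasure P] (hn : 0 < n)
    (ξ : Fin n → Ω → ℝ) (h0 : ∀ i ω, 0 ≤ ξ i ω) (h1 : ∀ i ω, ξ i ω ≤ 1) (m s x : ℝ) (hs : 0 ≤ s)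
    (hm : ∀ i, ∫ ω, ξ i ω ∂P = m) (hms : ∀ i i', i ≠ i' → ∫ ω, ξ i ω * ξ i' ω ∂P = s) :
    ∫ ω, ((∑ i, ξ i ω) / n - x) ^ 2 ∂P ≤ s + 1 / n - 2 * x * m + x ^ 2 := by
  have hn' : (0 : ℝ) < n := Nat.cast_pos.2 hn
  have e : ∀ ω, ((∑ i, ξ i ω) / n - x) ^ 2 =
      1 / (n : ℝ) ^ 2 * ∑ i, ∑ i', ξ i ω * ξ i' ω - 2 * x / n * ∑ i, ξ i ω + x ^ 2 := by
    intro ω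
    rw [← Finset.sum_mul_sum]
    field_simp
    ring
  simp only [e]
  rw [integral_add Integrable.of_finite Integrable.of_finite,
    integral_sub Integrable.of_finite Integrable.of_finite, integral_const_mul,
    integral_const_mul, integral_finsetSum _ fun _ _ => Integrable.of_finite,
    integral_finsetSum _ fun _ _ => Integrable.of_finite]
  simp only [hm, integral_const, probReal_univ, smul_eq_mul, one_mul, Finset.sum_const,
    Finset.card_univ, Fintype.card_fin, nsmul_eq_mul]
  have hsum : ∑ i, ∫ ω, ∑ i', ξ i ω * ξ i' ω ∂P ≤ (n : ℝ) ^ 2 * s + n := by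
    calc ∑ i, ∫ ω, ∑ i', ξ i ω * ξ i' ω ∂P
        -- Off the diagonal the terms equal `s`. On it they are at most `1`, and only this excess
        -- produces the error `1 / n`.
        ≤ ∑ i : Fin n, ∑ i' : Fin n, (s + if i = i' then (1 : ℝ) else 0) := by
          refine Finset.sum_le_sum fun i _ => ?_
          rw [integral_finsetSum _ fun _ _ => Integrable.of_finite]
          refine Finset.sum_le_sum fun i' _ => ?_
          by_cases h : i = i'
          · rw [if_pos h]
            calc ∫ ω, ξ i ω * ξ i' ω ∂P ≤ ∫ _, (1 : ℝ) ∂P :=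
                  integral_mono Integrable.of_finite Integrable.of_finite fun ω =>
                    mul_le_one₀ (h1 i ω) (h0 i' ω) (h1 i' ω)
              _ ≤ s + 1 := by simp [hs]
          · rw [if_neg h, add_zero, hms i i' h]
      _ = (n : ℝ) ^ 2 * s + n := by
          simp [Finset.sum_add_distrib]
          ring
  have h2 : 1 / (n : ℝ) ^ 2 * ∑ i, ∫ ω, ∑ i', ξ i ω * ξ i' ω ∂P ≤ s + 1 / n := by
    calc _ ≤ 1 / (n : ℝ) ^ 2 * ((n : ℝ) ^ 2 * s + n) :=
          mul_le_mul_of_nonneg_left hsum (by positivity)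
      _ = s + 1 / n := by field_simp
  have h3 : 2 * x / n * (n * m) = 2 * x * m := by field_simp
  rw [h3]
  linarith

theorem integral_flexibleRight_sq_le {α αf bl br : ℝ} (hbr : br ∈ Set.Icc (0 : ℝ) 1)
    (hn : 0 < n) :
    ∫ ω, (((flexibleRight ω).card : ℝ) / n - br) ^ 2 ∂graphLaw n α αf bl br ≤ 1 / n := by
  have h := integral_sq_average_sub_le (graphLaw n α αf bl br) hn
    (fun j ω => if ω.1.2 j = true then (1 : ℝ) else 0)
    (fun i ω => by split_ifs <;> norm_num)
    (fun i ω => by split_ifs <;> norm_num) br (br ^ 2) br (sq_nonneg _)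
    (fun j => by simpa using integral_flexibleRight hbr {j})
    (fun j j' hj => by
      have := integral_flexibleRight (α := α) (αf := αf) (bl := bl) hbr {j, j'}
      rw [Finset.card_pair hj] at this
      simp only [Finset.prod_pair hj] at this
      exact this)
  simp only [Finset.sum_boole] at h
  refine (h.trans_eq ?_)
  ring

/-- Isolation of two left nodes is correlated through the shared types of the right nodes, whence
the separate pair probability. The centre `x` is left free so that it can be the limiting density
rather than the mean for a given `n`. -/
theorem integral_isolatedLeft_sq_le {α αf bl br : ℝ} (hbl : bl ∈ Set.Icc (0 : ℝ) 1)
    (hbr : br ∈ Set.Icc (0 : ℝ) 1) (hp : 2 * α / n ∈ Set.Icc (0 : ℝ) 1)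
    (hpf : (α + αf) / n ∈ Set.Icc (0 : ℝ) 1) (hn : 0 < n) (x : ℝ) :
    ∫ ω, (((isolatedLeft ω).card : ℝ) / n - x) ^ 2 ∂graphLaw n α αf bl br ≤
      (1 - bl) ^ 2 * (br + (1 - br) * (1 - 2 * α / n) ^ 2) ^ n + 1 / n
        - 2 * x * ((1 - bl) * (br + (1 - br) * (1 - 2 * α / n)) ^ n) + x ^ 2 := by
  let ξ : Fin n → Types n × Edges n → ℝ := fun i ω => if i ∈ isolatedLeft ω then 1 else 0
  -- Isolation is rewritten as a product over right nodes, in which a flexible right node imposes no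
  -- condition; this is the form handled by `integral_regular_block`.
  have hξ : ∀ (S : Finset (Fin n)) (ω : Types n × Edges n), ∏ i ∈ S, ξ i ω =
      (∏ i ∈ S, if ω.1.1 i = true then (0 : ℝ) else 1) * ∏ j, ∏ i ∈ S,
        (fun f r : Bool => if f = true then (1 : ℝ) else if r = true then 0 else 1)
          (ω.1.2 j) (ω.2 i j) := by
    intro S ω
    rw [Finset.prod_comm, ← Finset.prod_mul_distrib]
    refine Finset.prod_congr rfl fun i _ => ?_
    simp only [ξ, mem_isolatedLeft]
    split_ifs with h1 h2 h2
    · simp [h1.1] at h2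
    · rw [Finset.prod_eq_one, one_mul]
      intro j _
      cases hj : ω.1.2 j
      · simp [h1.2 j hj]
      · simp
    · simp
    · have h3 : ∃ j, ω.1.2 j = false ∧ ω.2 i j = true := by
        by_contra hcon
        push Not at hcon
        exact h1 ⟨by simpa using h2, fun j hj => by simpa using hcon j hj⟩
      obtain ⟨j, hj, hj'⟩ := h3
      rw [Finset.prod_eq_zero (Finset.mem_univ j) (by simp [hj, hj']), mul_zero]
  have hint : ∀ S : Finset (Fin n), ∫ ω, ∏ i ∈ S, ξ i ω ∂graphLaw n α αf bl br =
      (1 - bl) ^ S.card * (br + (1 - br) * (1 - 2 * α / n) ^ S.card) ^ n := by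
    intro S
    simp only [hξ]
    rw [integral_regular_block hbl hbr hp hpf S Finset.univ
      (fun f r : Bool => if f = true then (1 : ℝ) else if r = true then 0 else 1)]
    simp
  have h := integral_sq_average_sub_le (graphLaw n α αf bl br) hn ξ
    (fun i ω => by dsimp only [ξ]; split_ifs <;> norm_num)
    (fun i ω => by dsimp only [ξ]; split_ifs <;> norm_num)
    ((1 - bl) * (br + (1 - br) * (1 - 2 * α / n)) ^ n)
    ((1 - bl) ^ 2 * (br + (1 - br) * (1 - 2 * α / n) ^ 2) ^ n) x
    (mul_nonneg (sq_nonneg _) (pow_nonneg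
      (add_nonneg hbr.1 (mul_nonneg (by linarith [hbr.2]) (sq_nonneg _))) _))
    (fun i => by simpa using hint {i})
    (fun i i' hi => by
      have := hint {i, i'}
      rw [Finset.card_pair hi] at this
      simp only [Finset.prod_pair hi] at this
      exact this)
  have hs : ∀ ω, ∑ i, ξ i ω = ((isolatedLeft ω).card : ℝ) := fun ω => by simp [ξ]
  simp only [hs] at h
  exact h

/-! ### Expected regular edges and the one-sided upper bound -/

/-- Single edges and pairs of adjacent edges are the blocks of shape 1×1, 1×2 and 2×1. An empty `S`
or `T` must be excluded: the product would be `1`, while the right side still requires the nodes of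
the other set to be regular. -/
theorem integral_prod_regEdge {α αf bl br : ℝ} (hbl : bl ∈ Set.Icc (0 : ℝ) 1)
    (hbr : br ∈ Set.Icc (0 : ℝ) 1) (hp : 2 * α / n ∈ Set.Icc (0 : ℝ) 1)
    (hpf : (α + αf) / n ∈ Set.Icc (0 : ℝ) 1) (S T : Finset (Fin n)) (hS : S.Nonempty)
    (hT : T.Nonempty) :
    ∫ ω, ∏ i ∈ S, ∏ j ∈ T, regEdge ω i j ∂graphLaw n α αf bl br =
      (1 - bl) ^ S.card * ((1 - br) * (2 * α / n) ^ S.card) ^ T.card := by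
  have h : ∀ ω : Types n × Edges n, ∏ i ∈ S, ∏ j ∈ T, regEdge ω i j =
      (∏ i ∈ S, if ω.1.1 i = true then (0 : ℝ) else 1) * ∏ j ∈ T, ∏ i ∈ S,
        (fun f r : Bool => if f = true then (0 : ℝ) else if r = true then 1 else 0)
          (ω.1.2 j) (ω.2 i j) := by
    intro ω
    rw [Finset.prod_comm (s := T), ← Finset.prod_mul_distrib]
    refine Finset.prod_congr rfl fun i _ => ?_
    cases hi : ω.1.1 i
    · simp only [Bool.false_eq_true, if_false, one_mul]
      refine Finset.prod_congr rfl fun j _ => ?_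
      cases hj : ω.1.2 j <;> simp [regEdge, hi, hj]
    · obtain ⟨j, hj⟩ := hT
      rw [Finset.prod_eq_zero hj (by simp [regEdge, hi])]
      simp
  simp only [h]
  rw [integral_regular_block hbl hbr hp hpf S T
      (fun f r : Bool => if f = true then (0 : ℝ) else if r = true then 1 else 0)]
  simp [hS.card_pos.ne']

/-- The factor `1 / 2` matters: adjacent pairs in rows and in columns each cost half of `n * (2α)² *
(1 - b)³`. -/
theorem sum_card_Iio_le (n : ℕ) : ∑ j : Fin n, ((Finset.Iio j).card : ℝ) ≤ (n : ℝ) ^ 2 / 2 := by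
  simp only [Fin.card_Iio]
  rw [Fin.sum_univ_eq_sum_range (fun i => (i : ℝ)) n]
  have h := Finset.sum_range_id_mul_two n
  have h' : (∑ i ∈ Finset.range n, (i : ℝ)) * 2 = (n : ℝ) * ((n - 1 : ℕ) : ℝ) := by
    rw [← Nat.cast_sum, ← Nat.cast_mul]
    exact_mod_cast h
  have h2 : ((n - 1 : ℕ) : ℝ) ≤ n := by exact_mod_cast Nat.sub_le n 1
  nlinarith [mul_le_mul_of_nonneg_left h2 (Nat.cast_nonneg (α := ℝ) n)]

/-- The expected size of the matching of regular nodes obtained by deleting an edge from each pair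
of adjacent edges. -/
theorem integral_regular_matching_ge {α αf b : ℝ} (hb : b ∈ Set.Icc (0 : ℝ) 1)
    (hp : 2 * α / n ∈ Set.Icc (0 : ℝ) 1)
    (hpf : (α + αf) / n ∈ Set.Icc (0 : ℝ) 1) (hn : 0 < n) :
    (n : ℝ) * (2 * α * (1 - b) ^ 2 - (2 * α) ^ 2 * (1 - b) ^ 3) ≤
      ∫ ω, (∑ i, ∑ j, regEdge ω i j
        - ∑ i, ∑ j, ∑ j' ∈ Finset.Iio j, regEdge ω i j' * regEdge ω i j
        - ∑ i, ∑ j, ∑ i' ∈ Finset.Iio i, regEdge ω i' j * regEdge ω i j)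
          ∂graphLaw n α αf b b := by
  have hn' : (0 : ℝ) < n := Nat.cast_pos.2 hn
  have e1 : ∀ i j, ∫ ω, regEdge ω i j ∂graphLaw n α αf b b = (1 - b) ^ 2 * (2 * α / n) := by
    intro i j
    have := integral_prod_regEdge hb hb hp hpf {i} {j} (by simp) (by simp)
    simp only [Finset.prod_singleton, Finset.card_singleton] at this
    rw [this]
    ring
  have e2 : ∀ i j, ∀ j' ∈ Finset.Iio j, ∫ ω, regEdge ω i j' * regEdge ω i j
      ∂graphLaw n α αf b b = (1 - b) ^ 3 * (2 * α / n) ^ 2 := by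
    intro i j j' hj
    have hne : j' ≠ j := (Finset.mem_Iio.1 hj).ne
    have := integral_prod_regEdge hb hb hp hpf {i} {j', j} (by simp) (by simp)
    simp only [Finset.prod_singleton, Finset.card_singleton, Finset.prod_pair hne,
      Finset.card_pair hne] at this
    rw [this]
    ring
  have e3 : ∀ i j, ∀ i' ∈ Finset.Iio i, ∫ ω, regEdge ω i' j * regEdge ω i j
      ∂graphLaw n α αf b b = (1 - b) ^ 3 * (2 * α / n) ^ 2 := by
    intro i j i' hi
    have hne : i' ≠ i := (Finset.mem_Iio.1 hi).ne
    have := integral_prod_regEdge hb hb hp hpf {i', i} {j} (by simp) (by simp)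
    simp only [Finset.prod_singleton, Finset.card_singleton, Finset.prod_pair hne,
      Finset.card_pair hne] at this
    rw [this]
    ring
  have isum : ∀ (s : Finset (Fin n)) (f : Fin n → Types n × Edges n → ℝ),
      ∫ ω, ∑ i ∈ s, f i ω ∂graphLaw n α αf b b = ∑ i ∈ s, ∫ ω, f i ω ∂graphLaw n α αf b b :=
    fun s f => integral_finsetSum _ fun _ _ => Integrable.of_finite
  rw [integral_sub Integrable.of_finite Integrable.of_finite,
    integral_sub Integrable.of_finite Integrable.of_finite]
  simp only [isum, e1]
  rw [Finset.sum_congr rfl fun i _ => Finset.sum_congr rfl fun j _ =>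
      Finset.sum_congr rfl (e2 i j),
    Finset.sum_congr rfl fun i _ => Finset.sum_congr rfl fun j _ =>
      Finset.sum_congr rfl (e3 i j)]
  simp only [Finset.sum_const, nsmul_eq_mul, Finset.card_univ, Fintype.card_fin]
  rw [← Finset.mul_sum]
  have hc : 0 ≤ (1 - b) ^ 3 * (2 * α / n) ^ 2 :=
    mul_nonneg (pow_nonneg (by linarith [hb.2]) _) (sq_nonneg _)
  have h1 := mul_le_mul_of_nonneg_right (sum_card_Iio_le n) hc
  have h2 := mul_le_mul_of_nonneg_left h1 hn'.le
  have h3 : (n : ℝ) * ((n : ℝ) ^ 2 / 2 * ((1 - b) ^ 3 * (2 * α / n) ^ 2)) =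
      n * ((2 * α) ^ 2 * (1 - b) ^ 3) / 2 := by
    field_simp
  have h4 : (n : ℝ) * (n * ((1 - b) ^ 2 * (2 * α / n))) = n * (2 * α * (1 - b) ^ 2) := by
    field_simp
  rw [← Finset.sum_mul, h4]
  linarith

/-- Without flexible right nodes, each of the `n` possible edges at a regular left node has
probability `2α / n`, so `αf` drops out of the bound. -/
theorem matchingProbN_one_sided_le {α αf B : ℝ} (hB : B ∈ Set.Icc (0 : ℝ) 1)
    (hp : 2 * α / n ∈ Set.Icc (0 : ℝ) 1) (hpf : (α + αf) / n ∈ Set.Icc (0 : ℝ) 1) (hn : 0 < n) :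
    matchingProbN n α αf B 0 ≤ B + 2 * α * (1 - B) := by
  have hn' : (0 : ℝ) < n := Nat.cast_pos.2 hn
  have h0 : (0 : ℝ) ∈ Set.Icc (0 : ℝ) 1 := ⟨le_rfl, zero_le_one⟩
  have e1 : ∀ i : Fin n, ∫ ω, (if ω.1.1 i = true then (1 : ℝ) else 0) ∂graphLaw n α αf B 0 =
      B := by
    intro i
    have h := integral_regular_block hB h0 hp hpf {i} ∅ fun _ _ => 0
    simp only [Finset.prod_singleton, Finset.prod_empty, mul_one, Finset.card_singleton, pow_one,
      Finset.card_empty, pow_zero] at h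
    have h2 : ∀ ω : Types n × Edges n, (if ω.1.1 i = true then (1 : ℝ) else 0) =
        1 - if ω.1.1 i = true then (0 : ℝ) else 1 := fun ω => by split_ifs <;> norm_num
    simp only [h2]
    rw [integral_sub Integrable.of_finite Integrable.of_finite, h]
    simp
  have e2 : ∀ i j : Fin n, ∫ ω, (if ω.1.1 i = true then (0 : ℝ) else 1) *
      (if ω.2 i j = true then (1 : ℝ) else 0) ∂graphLaw n α αf B 0 = (1 - B) * (2 * α / n) := by
    intro i j
    have h := integral_regular_block hB h0 hp hpf {i} {j} fun _ r => if r = true then 1 else 0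
    simp only [Finset.prod_singleton, Finset.card_singleton, pow_one] at h
    rw [h]
    simp
  have isum : ∀ f : Fin n → Types n × Edges n → ℝ,
      ∫ ω, ∑ i, f i ω ∂graphLaw n α αf B 0 = ∑ i, ∫ ω, f i ω ∂graphLaw n α αf B 0 :=
    fun f => integral_finsetSum _ fun _ _ => Integrable.of_finite
  have h := integral_mono (μ := graphLaw n α αf B 0) Integrable.of_finite Integrable.of_finite
    (maxMatchingSize_le_flexible_add (n := n))
  rw [integral_add Integrable.of_finite Integrable.of_finite] at h
  simp only [isum, e1, e2, Finset.sum_const, Finset.card_univ, Fintype.card_fin,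
    nsmul_eq_mul] at h
  rw [matchingProbN, integral_div, div_le_iff₀ hn']
  refine h.trans_eq ?_
  field_simp

/-! ### Lower bound for the balanced market at fixed size -/

/-- A pointwise form of Chebyshev's inequality. If both densities are within `ε / 2` of `x` and `b`,
then `(k - m) / n ≥ x - b - ε` and the exponential bound holds. Otherwise the penalty is at least `1
≥ m / n`, and the left side is not positive. -/
theorem cross_term_ge {k m : ℕ} {c x b ε : ℝ} (hn : 0 < n) (hm : m ≤ n) (hc0 : 0 ≤ c)
    (hc1 : c / n ≤ 1) (hε : 0 < ε) :
    (m : ℝ) / n - (m : ℝ) / n * Real.exp (-(c * (x - b - ε))) -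
        4 / ε ^ 2 * (((k : ℝ) / n - x) ^ 2 + ((m : ℝ) / n - b) ^ 2) ≤
      (m : ℝ) * (1 - (1 - c / n) ^ (k - m)) / n := by
  have hn' : (0 : ℝ) < n := Nat.cast_pos.2 hn
  set X : ℝ := (k : ℝ) / n with hX
  set Y : ℝ := (m : ℝ) / n with hY
  have hY0 : 0 ≤ Y := by positivity
  have hY1 : Y ≤ 1 := div_le_one_of_le₀ (by exact_mod_cast hm) hn'.le
  have hcn : 0 ≤ c / n := by positivity
  have hE := Real.exp_pos (-(c * (x - b - ε)))
  rw [mul_div_right_comm, ← hY]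
  by_cases hgood : |X - x| < ε / 2 ∧ |Y - b| < ε / 2
  · have hpow : (1 - c / n) ^ (k - m) ≤ Real.exp (-(c * (x - b - ε))) := by
      have h1 : 1 - c / n ≤ Real.exp (-(c / n)) := by
        have := Real.add_one_le_exp (-(c / n))
        linarith
      calc (1 - c / n) ^ (k - m) ≤ Real.exp (-(c / n)) ^ (k - m) :=
            pow_le_pow_left₀ (by linarith) h1 _
        _ = Real.exp (((k - m : ℕ) : ℝ) * -(c / n)) := (Real.exp_nat_mul _ _).symm
        _ ≤ Real.exp (-(c * (x - b - ε))) := by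
            refine Real.exp_le_exp.2 ?_
            have h2 : (k : ℝ) - m ≤ ((k - m : ℕ) : ℝ) := by
              have : k ≤ (k - m) + m := by omega
              have : (k : ℝ) ≤ ((k - m : ℕ) : ℝ) + m := by exact_mod_cast this
              linarith
            have h3 : c * (X - Y) ≤ ((k - m : ℕ) : ℝ) * (c / n) := by
              calc c * (X - Y) = ((k : ℝ) - m) * (c / n) := by rw [hX, hY]; field_simp
                _ ≤ _ := mul_le_mul_of_nonneg_right h2 hcn
            have h4 : x - b - ε ≤ X - Y := by
              have := (abs_lt.1 hgood.1).1
              have := (abs_lt.1 hgood.2).2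
              linarith
            have h5 := mul_le_mul_of_nonneg_left h4 hc0
            linarith
    have h1 : 0 ≤ 4 / ε ^ 2 * ((X - x) ^ 2 + (Y - b) ^ 2) := by positivity
    have h2 := mul_le_mul_of_nonneg_left hpow hY0
    linarith
  · have h1 : 1 ≤ 4 / ε ^ 2 * ((X - x) ^ 2 + (Y - b) ^ 2) := by
      rw [div_mul_eq_mul_div, le_div_iff₀ (by positivity)]
      have hsq : ∀ t : ℝ, ε / 2 ≤ |t| → (ε / 2) ^ 2 ≤ t ^ 2 := fun t ht => by
        rw [← sq_abs t]
        exact pow_le_pow_left₀ (by positivity) ht 2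
      by_cases hx : |X - x| < ε / 2
      · have := hsq _ (not_lt.1 fun h => hgood ⟨hx, h⟩)
        nlinarith [sq_nonneg (X - x)]
      · have := hsq _ (not_lt.1 hx)
        nlinarith [sq_nonneg (Y - b)]
    have h2 : (1 - c / n) ^ (k - m) ≤ 1 := pow_le_one₀ (by linarith) (by linarith)
    have h3 : 0 ≤ Y * (1 - (1 - c / n) ^ (k - m)) := mul_nonneg hY0 (by linarith)
    have h4 : 0 ≤ Y * Real.exp (-(c * (x - b - ε))) := by positivity
    linarith

theorem integral_crossMatchingSize_div_ge {α αf b ε : ℝ} (hb : b ∈ Set.Icc (0 : ℝ) 1)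
    (hp : 2 * α / n ∈ Set.Icc (0 : ℝ) 1) (hpf : (α + αf) / n ∈ Set.Icc (0 : ℝ) 1) (hn : 0 < n)
    (hε : 0 < ε) (x : ℝ) :
    b - b * Real.exp (-((α + αf) * (x - b - ε))) - 4 / ε ^ 2 *
        ((1 - b) ^ 2 * (b + (1 - b) * (1 - 2 * α / n) ^ 2) ^ n + 1 / n
          - 2 * x * ((1 - b) * (b + (1 - b) * (1 - 2 * α / n)) ^ n) + x ^ 2 + 1 / n) ≤
      (∫ ω, (crossMatchingSize ω : ℝ) ∂graphLaw n α αf b b) / n := by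
  have hn' : (0 : ℝ) < n := Nat.cast_pos.2 hn
  have hc0 : 0 ≤ α + αf := by
    have := mul_nonneg hpf.1 hn'.le
    rwa [div_mul_cancel₀ _ hn'.ne'] at this
  have h1 := div_le_div_of_nonneg_right
    (integral_crossMatchingSize_ge (bl := b) (br := b) hpf) hn'.le
  refine le_trans ?_ h1
  rw [← integral_div]
  have h2 := integral_mono (μ := graphLaw n α αf b b) Integrable.of_finite Integrable.of_finite
    fun ω => cross_term_ge (k := (isolatedLeft ω).card) (m := (flexibleRight ω).card) (x := x)
      (b := b) hn ((Finset.card_le_univ _).trans_eq (Fintype.card_fin n)) hc0 hpf.2 hε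
  refine le_trans ?_ h2
  have hY : ∫ ω, ((flexibleRight ω).card : ℝ) / n ∂graphLaw n α αf b b = b := by
    have hs : ∀ ω : Types n × Edges n, ((flexibleRight ω).card : ℝ) =
        ∑ j, if ω.1.2 j = true then (1 : ℝ) else 0 := fun ω => by simp [flexibleRight]
    simp only [hs]
    rw [integral_div, integral_finsetSum _ fun _ _ => Integrable.of_finite]
    have : ∀ j : Fin n, ∫ ω, (if ω.1.2 j = true then (1 : ℝ) else 0) ∂graphLaw n α αf b b = b :=
      fun j => by simpa using integral_flexibleRight hb {j}
    simp only [this, Finset.sum_const, Finset.card_univ, Fintype.card_fin, nsmul_eq_mul]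
    field_simp
  rw [integral_sub Integrable.of_finite Integrable.of_finite,
    integral_sub Integrable.of_finite Integrable.of_finite, integral_mul_const,
    integral_const_mul, integral_add Integrable.of_finite Integrable.of_finite, hY]
  exact sub_le_sub_left (mul_le_mul_of_nonneg_left
    (add_le_add (integral_isolatedLeft_sq_le hb hb hp hpf hn x) (integral_flexibleRight_sq_le hb hn))
    (by positivity)) _

theorem matchingProbN_balanced_ge {α αf b ε : ℝ} (hb : b ∈ Set.Icc (0 : ℝ) 1)
    (hp : 2 * α / n ∈ Set.Icc (0 : ℝ) 1) (hpf : (α + αf) / n ∈ Set.Icc (0 : ℝ) 1) (hn : 0 < n)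
    (hε : 0 < ε) (x : ℝ) :
    2 * α * (1 - b) ^ 2 - (2 * α) ^ 2 * (1 - b) ^ 3 +
      2 * (b - b * Real.exp (-((α + αf) * (x - b - ε))) - 4 / ε ^ 2 *
        ((1 - b) ^ 2 * (b + (1 - b) * (1 - 2 * α / n) ^ 2) ^ n + 1 / n
          - 2 * x * ((1 - b) * (b + (1 - b) * (1 - 2 * α / n)) ^ n) + x ^ 2 + 1 / n)) ≤
      matchingProbN n α αf b b := by
  have hn' : (0 : ℝ) < n := Nat.cast_pos.2 hn
  have h1 := integral_regular_matching_ge hb hp hpf hn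
  have h2 := integral_crossMatchingSize_div_ge hb hp hpf hn hε x
  have h3 := integral_mono (μ := graphLaw n α αf b b) Integrable.of_finite Integrable.of_finite
    (maxMatchingSize_ge (n := n))
  rw [integral_add Integrable.of_finite Integrable.of_finite,
    integral_add Integrable.of_finite Integrable.of_finite,
    integral_graphLaw_transpose α αf b fun ω => (crossMatchingSize ω : ℝ)] at h3
  rw [matchingProbN, integral_div]
  have h4 := div_le_div_of_nonneg_right h3 hn'.le
  have h5 := div_le_div_of_nonneg_right h1 hn'.le
  rw [mul_div_cancel_left₀ _ hn'.ne'] at h5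
  rw [add_div, add_div] at h4
  linarith

/-! ### Passage to the limit -/

/-- With `x` the limiting density of isolated nodes, the mean tends to `x` and the pair probability
to `x²`, because `exp (-4 * α * (1 - b))` is the square of `exp (-2 * α * (1 - b))`. The limit is
`x² - 2x² + x² = 0`. -/
theorem tendsto_isolatedLeft_bound (α b : ℝ) :
    Tendsto (fun n : ℕ => (1 - b) ^ 2 * (b + (1 - b) * (1 - 2 * α / n) ^ 2) ^ n + 1 / n
      - 2 * ((1 - b) * Real.exp (-2 * α * (1 - b))) *
        ((1 - b) * (b + (1 - b) * (1 - 2 * α / n)) ^ n)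
      + ((1 - b) * Real.exp (-2 * α * (1 - b))) ^ 2 + 1 / n) atTop (nhds 0) := by
  have hinv : Tendsto (fun n : ℕ => 1 / (n : ℝ)) atTop (nhds 0) :=
    tendsto_one_div_atTop_nhds_zero_nat
  have t1 : Tendsto (fun n : ℕ => (b + (1 - b) * (1 - 2 * α / n)) ^ n) atTop
      (nhds (Real.exp (-2 * α * (1 - b)))) := by
    have h := Real.tendsto_one_add_div_pow_exp (-2 * α * (1 - b))
    refine h.congr fun n => ?_
    congr 1
    ring
  have t2 : Tendsto (fun n : ℕ => (b + (1 - b) * (1 - 2 * α / n) ^ 2) ^ n) atTop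
      (nhds (Real.exp (-4 * α * (1 - b)))) := by
    have h : Tendsto (fun n : ℕ => (1 + (1 - b) * (-4 * α + 4 * α ^ 2 * (1 / n)) / n) ^ n) atTop
        (nhds (Real.exp (-4 * α * (1 - b)))) := by
      apply Real.tendsto_one_add_pow_exp_of_tendsto
      have h2 : Tendsto (fun n : ℕ => (1 - b) * (-4 * α + 4 * α ^ 2 * (1 / (n : ℝ)))) atTop
          (nhds ((1 - b) * (-4 * α + 4 * α ^ 2 * 0))) :=
        ((hinv.const_mul _).const_add _).const_mul _
      have h3 : (1 - b) * (-4 * α + 4 * α ^ 2 * 0) = -4 * α * (1 - b) := by ring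
      rw [h3] at h2
      refine h2.congr' ?_
      filter_upwards [eventually_gt_atTop 0] with n hn
      have hn' : (n : ℝ) ≠ 0 := Nat.cast_ne_zero.2 hn.ne'
      rw [mul_div_cancel₀ _ hn']
    refine h.congr fun n => ?_
    congr 1
    ring
  have h := (((((t2.const_mul ((1 - b) ^ 2)).add hinv).sub
    ((t1.const_mul (1 - b)).const_mul (2 * ((1 - b) * Real.exp (-2 * α * (1 - b)))))).add_const
      (((1 - b) * Real.exp (-2 * α * (1 - b))) ^ 2)).add hinv)
  have he : Real.exp (-4 * α * (1 - b)) = Real.exp (-2 * α * (1 - b)) ^ 2 := by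
    rw [← Real.exp_nat_mul]
    congr 1
    push_cast
    ring
  convert h using 2
  rw [he]
  ring

theorem eventually_div_mem_Icc {c : ℝ} (hc : 0 ≤ c) :
    ∀ᶠ n : ℕ in atTop, c / n ∈ Set.Icc (0 : ℝ) 1 := by
  filter_upwards [eventually_ge_atTop ⌈c⌉₊] with n hn
  exact ⟨by positivity, div_le_one_of_le₀ (Nat.ceil_le.1 hn) (Nat.cast_nonneg n)⟩

theorem matchingProb_one_sided_le {α αf B : ℝ} (hB : B ∈ Set.Icc (0 : ℝ) 1) (hα : 0 ≤ α)
    (hc : 0 ≤ α + αf) : matchingProb α αf B 0 ≤ B + 2 * α * (1 - B) := by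
  refine limsup_le_of_le (IsBoundedUnder.isCoboundedUnder_le ⟨0, ?_⟩) ?_
  · exact eventually_map.2 (Eventually.of_forall fun n => (matchingProbN_mem_Icc n α αf B 0).1)
  · filter_upwards [eventually_div_mem_Icc (c := 2 * α) (by positivity), eventually_div_mem_Icc hc,
      eventually_gt_atTop 0] with n h1 h2 h3
    exact matchingProbN_one_sided_le hB h1 h2 h3

theorem matchingProb_balanced_ge {α αf b ε : ℝ} (hb : b ∈ Set.Icc (0 : ℝ) 1) (hα : 0 ≤ α)
    (hc : 0 ≤ α + αf) (hε : 0 < ε) :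
    2 * α * (1 - b) ^ 2 - (2 * α) ^ 2 * (1 - b) ^ 3 + 2 * (b - b * Real.exp (-((α + αf) *
      ((1 - b) * Real.exp (-2 * α * (1 - b)) - b - ε)))) ≤ matchingProb α αf b b := by
  have ht := ((((tendsto_isolatedLeft_bound α b).const_mul (4 / ε ^ 2)).const_sub
    (b - b * Real.exp (-((α + αf) * ((1 - b) * Real.exp (-2 * α * (1 - b)) - b - ε))))).const_mul
      2).const_add (2 * α * (1 - b) ^ 2 - (2 * α) ^ 2 * (1 - b) ^ 3)
  rw [mul_zero, sub_zero] at ht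
  -- For fixed `ε` the bounds at size `n` converge to the left side, so eventually they exceed any
  -- smaller `z`, and so does the upper limit.
  refine le_of_forall_lt fun y hy => ?_
  obtain ⟨z, hyz, hz⟩ := exists_between hy
  refine hyz.trans_le (le_limsup_of_frequently_le (Eventually.frequently ?_) ⟨1, ?_⟩)
  · filter_upwards [eventually_div_mem_Icc (c := 2 * α) (by positivity), eventually_div_mem_Icc hc,
      eventually_gt_atTop 0, ht.eventually_const_lt hz] with n h1 h2 h3 h4
    exact h4.le.trans (matchingProbN_balanced_ge hb h1 h2 h3 hε _)
  · exact eventually_map.2 (Eventually.of_forall fun n => (matchingProbN_mem_Icc n α αf b b).2)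

end Flex

/-! ### Comparison of the two bounds -/

theorem theorem3 (B : ℝ) (hB0 : 0 < B) (hB1 : B < 1) (α : ℝ) (hα0 : 0 < α)
    (hα : α < Flex.alphaStar B) :
    -- the threshold for `αf` is well defined
    (0 < 2 * α * ((B / 2) ^ 2 - 2 * α * (1 - B / 2) ^ 3) ∧
      (1 - B / 2) * Real.exp (-2 * α * (1 - B / 2)) - B / 2 ≠ 0) ∧
    -- the balanced allocation is strictly better than the one-sided one
    ∀ αf : ℝ, Flex.alphaFStar B α < αf →
      Flex.matchingProb α αf B 0 < Flex.matchingProb α αf (B / 2) (B / 2) := by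
  have hb : 0 < 1 - B / 2 := by linarith
  obtain ⟨hα1, hα2⟩ := lt_min_iff.1 hα
  have hΔ : 0 < 2 * α * ((B / 2) ^ 2 - 2 * α * (1 - B / 2) ^ 3) := by
    rw [lt_div_iff₀ (by positivity)] at hα1
    refine mul_pos (by positivity) ?_
    linarith
  -- The second term of `alphaStar` is exactly what gives `exp (-2 * α * (1 - B / 2)) > B / (2 -
  -- B)`: asymptotically, isolated regular nodes outnumber the flexible nodes opposite them.
  have hD : 0 < (1 - B / 2) * Real.exp (-2 * α * (1 - B / 2)) - B / 2 := by
    have h1 : 2 * α * (1 - B / 2) < Real.log ((2 - B) / B) := by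
      rw [div_mul_eq_mul_div, one_mul, lt_div_iff₀ (by positivity)] at hα2
      linarith
    have h2 : Real.exp (-Real.log ((2 - B) / B)) < Real.exp (-2 * α * (1 - B / 2)) :=
      Real.exp_lt_exp.2 (by linarith)
    rw [Real.exp_neg, Real.exp_log (div_pos (by linarith) hB0), inv_div,
      div_lt_iff₀ (by linarith)] at h2
    linarith
  refine ⟨⟨hΔ, hD.ne'⟩, fun αf hαf => ?_⟩
  set D := (1 - B / 2) * Real.exp (-2 * α * (1 - B / 2)) - B / 2 with hDdef
  set Δ := 2 * α * ((B / 2) ^ 2 - 2 * α * (1 - B / 2) ^ 3) with hΔdef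
  have hlog : Real.log B - Real.log Δ < αf * D := (div_lt_iff₀ hD).1 hαf
  -- This makes the numerator of `alphaFStar` positive, hence `αf > 0`. Since `8 * (1 - B / 2) ^ 3 ≥
  -- 1`, the first term of `alphaStar` forces `α < B ^ 2`.
  have hΔB : Δ < B := by
    have h1 : 8 * α * (1 - B / 2) ^ 3 < B ^ 2 := by
      rw [lt_div_iff₀ (by positivity)] at hα1
      linarith
    have h2 : (1 / 2 : ℝ) ^ 3 ≤ (1 - B / 2) ^ 3 :=
      pow_le_pow_left₀ (by norm_num) (by linarith) 3
    have h3 : α < B ^ 2 := by nlinarith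
    have h4 : Δ ≤ 2 * α * (B / 2) ^ 2 := by
      rw [hΔdef]
      refine mul_le_mul_of_nonneg_left ?_ (by positivity)
      have : 0 ≤ 2 * α * (1 - B / 2) ^ 3 := by positivity
      linarith
    nlinarith [mul_pos hB0 hB0, mul_pos (mul_pos hB0 hB0) hα0]
  have hαf0 : 0 < αf := by
    have h1 : 0 < Real.log B - Real.log Δ := sub_pos.2 (Real.log_lt_log hΔ hΔB)
    exact pos_of_mul_pos_left (h1.trans hlog) hD.le
  have hc : 0 < α + αf := by positivity
  -- The condition on `αf`, exponentiated: the total greedy loss is below the gain `Δ`.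
  have hgap : B * Real.exp (-(αf * D)) < Δ := by
    rw [← Real.log_lt_log_iff (by positivity) hΔ,
      Real.log_mul hB0.ne' (Real.exp_pos _).ne', Real.log_exp]
    linarith
  have hup := Flex.matchingProb_one_sided_le (α := α) (αf := αf) (B := B) ⟨hB0.le, hB1.le⟩
    hα0.le hc.le
  -- The true rate is `(α + αf) * D`, while only `αf * D` is needed. This `ε` spends precisely the
  -- surplus `α * D`.
  have hlow := Flex.matchingProb_balanced_ge (α := α) (αf := αf) (b := B / 2)
    (ε := α * D / (α + αf)) ⟨by positivity, by linarith⟩ hα0.le hc.le (by positivity)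
  have he : (α + αf) * ((1 - B / 2) * Real.exp (-2 * α * (1 - B / 2)) - B / 2 -
      α * D / (α + αf)) = αf * D := by
    rw [← hDdef]
    field_simp
    ring
  rw [he] at hlow
  have hid : 2 * α * (1 - B / 2) ^ 2 - (2 * α) ^ 2 * (1 - B / 2) ^ 3 =
      2 * α * (1 - B) + Δ := by
    rw [hΔdef]
    ring
  linarith
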